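/- Let $\mathbb K=\mathbb R$ or $\mathbb C$, and let $|\cdot|$ be the Euclidean norm on $\mathbb K^r$. All functions below are germs at the origin of $\mathbb K^r$ or of $\mathbb K^r\times\mathbb K$ (coordinates $(x,t)$), so every identity and inequality is required only near the origin. $\mathcal O_r$ is the ring of germs at $0$ of $\mathbb K$-analytic functions on $\mathbb K^r$. Let $M_0$ be an $n\times(n+1)$ matrix with entries in $\mathcal O_r$ and $M_0(0)=0$ that defines a codimension $2$ Cohen–Macaulay isolated singularity. That is, if $f_1,\dots,f_{n+1}$ are the maximal minors of $M_0$ and $I=(f_1,\dots,f_{n+1})\subset\mathcal O_r$, then $\mathcal O_r/I$ is Cohen–Macaulay of dimension $r-2$, and at every point $x\neq0$ near $0$ with $f_1(x)=\dots=f_{n+1}(x)=0$ the Jacobian matrix of $(f_1,\dots,f_{n+1})$ has rank $2$. Let $M(x,t)$ be a one-parameter deformation of $M_0$, i.e. an $n\times(n+1)$ matrix of germs of $\mathbb K$-analytic functions on $\mathbb K^r\times\mathbb K$ with $M(x,0)=M_0(x)$. For a matrix $A$ let $C_{lk}(A)$ (resp. $R_{lk}(A)$) be the matrix of the same size whose $l$-th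 column (resp. row) is the $k$-th column (resp. row) of $A$ and whose other entries are $0$. A control function is a function $\rho(x,t)\ge0$ with $\rho(0,t)=0$, of class $C^1$ at the points with $x\neq0$, such that $\rho(x,t)\ge c|x|^\alpha$ for some constants $c,\alpha>0$. Suppose that there are a control function $\rho$, $\mathbb K$-valued germs $\xi_i,L_{lk},S_{ab}$ at $0\in\mathbb K^r\times\mathbb K$ that are real-analytic (for $\mathbb K=\mathbb C$: in the underlying real variables), and constants $C_1,C_2,C_3$ such that $$\rho^2\frac{\partial M}{\partial t}=\sum_{i=1}^r\xi_i\frac{\partial M}{\partial x_i}+\sum_{l,k=1}^{n+1}L_{lk}\,C_{lk}(M)+\sum_{a,b=1}^{n}S_{ab}\,R_{ab}(M),$$ $\xi_i(0,t)=0$, and, for $x\ne0$ and all indices, $$\frac{|\xi_i(x,t)|}{\rho^2(x,t)}\le C_1|x|,\qquad \frac{|L_{lk}(x,t)|}{\rho^2(x,t)}\le C_2|x|,\qquad \frac{|S_{ab}(x,t)|}{\rho^2(x,t)}\le C_3|x|.$$ Then the family $M$ is $C^0$-$\mathcal G$-trivial: there are a germ of homeomorphism $\Phi(x,t)=(\phi(x,t),t)$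 of $(\mathbb K^r\times\mathbb K,0)$ with $\Phi(x,0)=(x,0)$ and $\phi(0,t)=0$, and germs at $0$ of continuous families $A(x,t)\in GL_n(\mathbb K)$, $B(x,t)\in GL_{n+1}(\mathbb K)$ with $A(x,0)=I_n$, $B(x,0)=I_{n+1}$, such that $$M_0(x)=A(x,t)^{-1}\,M(\Phi(x,t))\,B(x,t).$$ -/

import Mathlib

open Filter Topology

noncomputable section

namespace CM2

/-- `𝕜ʳ` with its Euclidean norm, where `𝕜` is `ℝ` or `ℂ`. -/
abbrev Space (𝕜 : Type*) (r : ℕ) : Type _ := EuclideanSpace 𝕜 (Fin r)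

/-- The ring `𝒪_r` of germs at the origin of `𝕜`-analytic functions `𝕜ʳ → 𝕜`. -/
def AnalyticGerms (𝕜 : Type*) [RCLike 𝕜] (r : ℕ) :
    Subring (Germ (𝓝 (0 : Space 𝕜 r)) 𝕜) where
  carrier := {g | ∃ f : Space 𝕜 r → 𝕜, AnalyticAt 𝕜 f 0 ∧ g = (↑f : Germ (𝓝 (0 : Space 𝕜 r)) 𝕜)}
  mul_mem' := by
    rintro _ _ ⟨f, hf, rfl⟩ ⟨g, hg, rfl⟩
    exact ⟨f * g, hf.mul hg, rfl⟩
  one_mem' := ⟨1, analyticAt_const, rfl⟩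
  add_mem' := by
    rintro _ _ ⟨f, hf, rfl⟩ ⟨g, hg, rfl⟩
    exact ⟨f + g, hf.add hg, rfl⟩
  zero_mem' := ⟨0, analyticAt_const, rfl⟩
  neg_mem' := by
    rintro _ ⟨f, hf, rfl⟩
    exact ⟨-f, hf.neg, rfl⟩

/-- The `j`-th maximal minor of an `n × (n+1)` matrix: the `j`-th column is removed. -/
def maxMinor {R : Type*} [CommRing R] {n : ℕ} (A : Matrix (Fin n) (Fin (n + 1)) R)
    (j : Fin (n + 1)) : R :=
  (A.submatrix id j.succAbove).det

/-- The ideal of `𝒪_r` generated by the germs of the maximal minors of `M₀`. -/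
def minorIdeal {𝕜 : Type*} [RCLike 𝕜] {r n : ℕ}
    (M₀ : Space 𝕜 r → Matrix (Fin n) (Fin (n + 1)) 𝕜) : Ideal (AnalyticGerms 𝕜 r) :=
  Ideal.span {g | ∃ j : Fin (n + 1),
    (g : Germ (𝓝 (0 : Space 𝕜 r)) 𝕜) = ((fun x => maxMinor (M₀ x) j : Space 𝕜 r → 𝕜) :
      Germ (𝓝 (0 : Space 𝕜 r)) 𝕜)}

/-- The (representative of a) germ `M₀` of an `n × (n+1)` matrix of analytic functions with entries
in the maximal ideal defines, by its maximal minors, a codimension 2 Cohen-Macaulay isolated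
singularity `(X, 0)` in `(𝕜ʳ, 0)`. -/
structure IsCodimTwoCMIsolatedSingularity {𝕜 : Type*} [RCLike 𝕜] {r n : ℕ}
    (M₀ : Space 𝕜 r → Matrix (Fin n) (Fin (n + 1)) 𝕜) : Prop where
  analytic : ∀ i j, AnalyticAt 𝕜 (fun x => M₀ x i j) 0
  map_zero : M₀ 0 = 0
  /-- The local ring `𝒪_r / I` of `X` has dimension `r - 2`. -/
  codim_two : ringKrullDim (AnalyticGerms 𝕜 r ⧸ minorIdeal M₀) + 2 = (r : WithBot ℕ∞)
  /-- `𝒪_r / I` is Cohen-Macaulay: it has a regular sequence of germs vanishing at the origin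
  whose length is its dimension. -/
  cohenMacaulay : ∃ rs : List (AnalyticGerms 𝕜 r),
    (∀ g ∈ rs, (g : Germ (𝓝 (0 : Space 𝕜 r)) 𝕜).value = 0) ∧
    RingTheory.Sequence.IsRegular (AnalyticGerms 𝕜 r ⧸ minorIdeal M₀) rs ∧
    ((rs.length : ℕ) : WithBot ℕ∞) = ringKrullDim (AnalyticGerms 𝕜 r ⧸ minorIdeal M₀)
  /-- Near the origin, `X` is smooth of codimension 2 at each of its points other than `0`:
  its equations have Jacobian matrix of rank 2 there. -/
  isolated : ∀ᶠ x in 𝓝 (0 : Space 𝕜 r), x ≠ 0 → (∀ j, maxMinor (M₀ x) j = 0) →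
    Module.finrank 𝕜
      (fderiv 𝕜 (fun y : Space 𝕜 r => fun j => maxMinor (M₀ y) j) x).range = 2

/-- `M` is (a representative of) a one parameter analytic deformation of the germ `M₀`. -/
structure IsDeformation {𝕜 : Type*} [RCLike 𝕜] {r n p : ℕ}
    (M₀ : Space 𝕜 r → Matrix (Fin n) (Fin p) 𝕜)
    (M : Space 𝕜 r × 𝕜 → Matrix (Fin n) (Fin p) 𝕜) : Prop where
  analytic : ∀ i j, AnalyticAt 𝕜 (fun q => M q i j) 0
  restrict : ∀ᶠ x in 𝓝 (0 : Space 𝕜 r), M (x, 0) = M₀ x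

/-- Control functions near the origin of `𝕜ʳ × 𝕜`: non-negative, zero on the parameter axis,
`C¹` off this axis, and satisfying a Łojasiewicz condition in `x`, uniformly in the parameter. -/
structure IsControlFunction {𝕜 : Type*} [RCLike 𝕜] {r : ℕ} (ρ : Space 𝕜 r × 𝕜 → ℝ) : Prop where
  nonneg : ∀ᶠ q in 𝓝 (0 : Space 𝕜 r × 𝕜), 0 ≤ ρ q
  zero_axis : ∀ᶠ t in 𝓝 (0 : 𝕜), ρ (0, t) = 0
  smooth : ∀ᶠ q in 𝓝 (0 : Space 𝕜 r × 𝕜), q.1 ≠ 0 → ContDiffAt ℝ 1 ρ q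
  lojasiewicz : ∃ c > (0 : ℝ), ∃ α > (0 : ℝ),
    ∀ᶠ q in 𝓝 (0 : Space 𝕜 r × 𝕜), c * ‖q.1‖ ^ α ≤ ρ q

/-- `C_{lk}(A)`: the `l`-th column is the `k`-th column of `A`, all other columns vanish. -/
def colMat {R : Type*} [Zero R] {n p : ℕ} (l k : Fin p) (A : Matrix (Fin n) (Fin p) R) :
    Matrix (Fin n) (Fin p) R :=
  Matrix.of fun i j => if j = l then A i k else 0

/-- `R_{lk}(A)`: the `l`-th row is the `k`-th row of `A`, all other rows vanish. -/
def rowMat {R : Type*} [Zero R] {n p : ℕ} (l k : Fin n) (A : Matrix (Fin n) (Fin p) R) :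
    Matrix (Fin n) (Fin p) R :=
  Matrix.of fun i j => if i = l then A k j else 0

/-- The matrix `∂M/∂t` at the point `q = (x, t)`. -/
def partialT {𝕜 : Type*} [RCLike 𝕜] {r n p : ℕ}
    (M : Space 𝕜 r × 𝕜 → Matrix (Fin n) (Fin p) 𝕜) (q : Space 𝕜 r × 𝕜) :
    Matrix (Fin n) (Fin p) 𝕜 :=
  Matrix.of fun a b => deriv (fun s : 𝕜 => M (q.1, s) a b) q.2

/-- The matrix `∂M/∂xᵢ` at the point `q = (x, t)`. -/
def partialX {𝕜 : Type*} [RCLike 𝕜] {r n p : ℕ}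
    (M : Space 𝕜 r × 𝕜 → Matrix (Fin n) (Fin p) 𝕜) (i : Fin r) (q : Space 𝕜 r × 𝕜) :
    Matrix (Fin n) (Fin p) 𝕜 :=
  Matrix.of fun a b =>
    fderiv 𝕜 (fun x : Space 𝕜 r => M (x, q.2) a b) q.1 (EuclideanSpace.single i 1)

/-- The deformation `M` of `M₀` is `C⁰`-`𝒢`-trivial: there are a germ of homeomorphism
`Φ (x, t) = (φ (x, t), t)` of `(𝕜ʳ × 𝕜, 0)` with `Φ (x, 0) = (x, 0)`, `φ (0, t) = 0`, and germs of
continuous families `A`, `B` of invertible matrices with `A (x, 0) = 1`, `B (x, 0) = 1`, such that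
`M₀ = A⁻¹ (M ∘ Φ) B`. -/
def IsC0GTrivial {𝕜 : Type*} [RCLike 𝕜] {r n p : ℕ}
    (M₀ : Space 𝕜 r → Matrix (Fin n) (Fin p) 𝕜)
    (M : Space 𝕜 r × 𝕜 → Matrix (Fin n) (Fin p) 𝕜) : Prop :=
  ∃ (Φ : OpenPartialHomeomorph (Space 𝕜 r × 𝕜) (Space 𝕜 r × 𝕜))
    (A : Space 𝕜 r × 𝕜 → Matrix (Fin n) (Fin n) 𝕜)
    (B : Space 𝕜 r × 𝕜 → Matrix (Fin p) (Fin p) 𝕜),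
    (0 : Space 𝕜 r × 𝕜) ∈ Φ.source ∧
    (∀ q ∈ Φ.source, (Φ q).2 = q.2) ∧
    (∀ x : Space 𝕜 r, (x, 0) ∈ Φ.source → Φ (x, 0) = (x, 0)) ∧
    (∀ t : 𝕜, (0, t) ∈ Φ.source → Φ (0, t) = (0, t)) ∧
    ContinuousOn A Φ.source ∧ ContinuousOn B Φ.source ∧
    (∀ q ∈ Φ.source, IsUnit (A q) ∧ IsUnit (B q)) ∧
    (∀ x : Space 𝕜 r, (x, 0) ∈ Φ.source → A (x, 0) = 1 ∧ B (x, 0) = 1) ∧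
    ∀ q ∈ Φ.source, M₀ q.1 = (A q)⁻¹ * M (Φ q) * B q

end CM2

end

/-!
The proof integrates the infinitesimal equation. Divided by `ρ²`, it says that off the axis `x = 0`
the derivative of `M` along `V + ∂/∂t`, with `V = -∑ (ξᵢ / ρ²) ∂/∂xᵢ`, is `M P + Q M`, where the
matrices `P`, `Q` come from `L / ρ²` and `S / ρ²` (`fderiv_liftField`). Following `V + ∂/∂t` above the
segment from `0` to `t`, and transporting frames by `C' = -t C Q` and `B' = -t P B`, the product
`C M B` stays constant (`mul_mul_eq_of_hasDerivWithinAt`), so that it equals its initial value `M₀`.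
Hence the time `1` flow `Φ` and the matrices `A = C⁻¹`, `B` are as required. Working above segments
treats real and complex parameters alike.

The field is `C¹` off the axis, but possibly not Lipschitz at the axis; instead, it is bounded there by
a multiple of `‖x‖`. After shrinking `t`, the trajectory of a point `(x, t)`, with its frames, moves by
at most `‖x‖ / 4` during `[0, 1]`. It therefore stays in a ball that avoids the axis, where the
Picard-Lindelöf theorem gives existence, uniqueness and continuous dependence
(`IsAxisDominated.isPicardLindelof`, `IsTrajectory.eqOn_base`). The same bound shows that the flow
fixes the axis and is continuous along it (`IsAxisDominated.exists_flow`). The inverse of the flow is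
the flow based at time `1`. At the points of the axis the identity `M₀ = A⁻¹ (M ∘ Φ) B` is the limit
of the identity nearby (`isC0GTrivial_of_liftingData`); this uses that the axis has empty interior,
that is, `r ≠ 0`.
-/

namespace CM2

open Metric Set Function
open scoped NNReal

/-! ### Trajectories of vector fields that are dominated by the distance to an axis -/

section ProductBalls

variable {E H : Type*} [NormedAddCommGroup E] [NormedAddCommGroup H] {h₀ : H} {δ : ℝ}

theorem norm_fst_lt_of_mem_ball {z : E × H} {R : ℝ} (hz : z ∈ ball ((0, h₀) : E × H) R) :
    ‖z.1‖ < R := by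
  have := (norm_fst_le (z - (0, h₀))).trans_lt (mem_ball_iff_norm.1 hz)
  simpa using this

theorem closedBall_subset_ball_of_half {z : E × H} (hz : z ∈ ball ((0, h₀) : E × H) (δ / 2)) :
    closedBall z (3 / 4 * ‖z.1‖) ⊆ ball ((0, h₀) : E × H) δ := by
  refine closedBall_subset_ball' ?_
  have := norm_fst_lt_of_mem_ball hz
  have := mem_ball.1 hz
  have := norm_nonneg z.1
  linarith

theorem fst_ne_zero_of_mem_closedBall {z w : E × H} (hz : z.1 ≠ 0)
    (hw : w ∈ closedBall z (3 / 4 * ‖z.1‖)) : w.1 ≠ 0 := by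
  intro h0
  have h1 := (norm_fst_le (w - z)).trans (mem_closedBall_iff_norm.1 hw)
  have := norm_pos_iff.2 hz
  simp only [Prod.fst_sub, h0, zero_sub, norm_neg] at h1
  linarith

end ProductBalls

section AxisDominated

variable {E H : Type*} [NormedAddCommGroup E] [NormedSpace ℝ E] [NormedAddCommGroup H]
  [NormedSpace ℝ H]

/-- A time-dependent vector field `F` on `E × H` that, for times in `[0, 1]` and on the ball of radius
`δ` about `(0, h₀)`, is `C¹` off the axis `{0} × H` and bounded by `‖x‖ / 8` at `(x, h)`. In particular
`F` vanishes on the axis; it need not be Lipschitz near it. The constant `1 / 8` is small enough for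
trajectories to stay, up to time `1`, at a distance at most `‖x‖ / 4` from their initial point
`(x, h)`. -/
structure IsAxisDominated (F : ℝ → E × H → E × H) (h₀ : H) (δ : ℝ) : Prop where
  contDiffAt : ∀ s ∈ Icc (0 : ℝ) 1, ∀ z ∈ ball ((0, h₀) : E × H) δ, z.1 ≠ 0 →
    ContDiffAt ℝ 1 (uncurry F) (s, z)
  norm_le : ∀ s ∈ Icc (0 : ℝ) 1, ∀ z ∈ ball ((0, h₀) : E × H) δ, ‖F s z‖ ≤ ‖z.1‖ / 8

/-- `γ` is a trajectory of `F` over `[0, 1]` that passes through `z = (x, h)` at time `τ` and stays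
within `‖x‖ / 4` of `z`. The last condition keeps `γ` off the axis when `x ≠ 0`, and makes it constant
when `x = 0`. -/
structure IsTrajectory (F : ℝ → E × H → E × H) (τ : ℝ) (z : E × H) (γ : ℝ → E × H) : Prop where
  base : γ τ = z
  hasDerivWithinAt : ∀ s ∈ Icc (0 : ℝ) 1, HasDerivWithinAt γ (F s (γ s)) (Icc 0 1) s
  mem_closedBall : ∀ s ∈ Icc (0 : ℝ) 1, γ s ∈ closedBall z (‖z.1‖ / 4)

/-- The local flow of the Picard-Lindelöf theorem, Lipschitz in the initial point, with the
additional information that its trajectories stay in the ball on which the field is controlled. -/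
theorem exists_flow_mem_closedBall {V : Type*} [NormedAddCommGroup V] [NormedSpace ℝ V]
    [CompleteSpace V] {f : ℝ → V → V} {a b : ℝ} {t₀ : Icc a b} {x₀ : V} {R r L K : ℝ≥0}
    (hf : IsPicardLindelof f t₀ x₀ R r L K) :
    ∃ α : V → ℝ → V, (∀ x ∈ closedBall x₀ r, α x t₀ = x ∧
      (∀ t ∈ Icc a b, HasDerivWithinAt (α x) (f t (α x t)) (Icc a b) t) ∧
      ∀ t, α x t ∈ closedBall x₀ R) ∧
      ∃ L' : ℝ≥0, ∀ t ∈ Icc a b, LipschitzOnWith L' (α · t) (closedBall x₀ r) := by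
  classical
  have key (x) (hx : x ∈ closedBall x₀ r) := ODE.FunSpace.exists_isFixedPt_next hf hx
  choose α hα using key
  refine ⟨fun x => if hx : x ∈ closedBall x₀ r then (α x hx).compProj else 0,
    fun x hx => ?_, ?_⟩
  · simp only [dif_pos hx]
    refine ⟨?_, fun t ht => ?_, fun t => (α x hx).compProj_mem_closedBall hf.mul_max_le⟩
    · rw [ODE.FunSpace.compProj_val, ← hα, ODE.FunSpace.next_apply₀]
    · refine (ODE.hasDerivWithinAt_picard_Icc t₀.2 hf.continuousOn_uncurry
        (α x hx).continuous_compProj.continuousOn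
        (fun _ _ => (α x hx).compProj_mem_closedBall hf.mul_max_le) x ht).congr_of_mem ?_ ht
      intro t' ht'
      nth_rw 1 [← hα]
      rw [ODE.FunSpace.compProj_of_mem ht', ODE.FunSpace.next_apply]
  · obtain ⟨L', h⟩ := ODE.FunSpace.exists_forall_closedBall_funSpace_dist_le_mul hf
    refine ⟨L', fun t ht => LipschitzOnWith.of_dist_le_mul fun x hx y hy => ?_⟩
    simp only [dif_pos hx, dif_pos hy, ODE.FunSpace.compProj_apply]
    have : Nonempty (Icc a b) := ⟨t₀⟩
    exact ContinuousMap.dist_le_iff_of_nonempty.mp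
      (h x y hx hy (α x hx) (α y hy) (hα x hx) (hα y hy)) _

/-- Two-sided uniqueness on a closed interval, where the common point may be attained at an end. -/
theorem eqOn_of_trajectories {V : Type*} [NormedAddCommGroup V] [NormedSpace ℝ V]
    {f : ℝ → V → V} {a b τ : ℝ} {K : ℝ≥0} {s : Set V}
    (hf : ∀ t ∈ Icc a b, LipschitzOnWith K (f t) s) (hτ : τ ∈ Icc a b) {γ η : ℝ → V}
    (hγ : ∀ t ∈ Icc a b, HasDerivWithinAt γ (f t (γ t)) (Icc a b) t)
    (hη : ∀ t ∈ Icc a b, HasDerivWithinAt η (f t (η t)) (Icc a b) t)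
    (hγs : ∀ t ∈ Icc a b, γ t ∈ s) (hηs : ∀ t ∈ Icc a b, η t ∈ s) (h : γ τ = η τ) :
    EqOn γ η (Icc a b) := by
  have cont {g : ℝ → V} (hg : ∀ t ∈ Icc a b, HasDerivWithinAt g (f t (g t)) (Icc a b) t) :
      ContinuousOn g (Icc a b) := fun t ht => (hg t ht).continuousWithinAt
  have right {g : ℝ → V} (hg : ∀ t ∈ Icc a b, HasDerivWithinAt g (f t (g t)) (Icc a b) t)
      (t) (ht : t ∈ Ico τ b) : HasDerivWithinAt g (f t (g t)) (Ici t) t :=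
    (hg t ⟨hτ.1.trans ht.1, ht.2.le⟩).mono_of_mem_nhdsWithin
      (mem_of_superset (Icc_mem_nhdsGE ht.2) (Icc_subset_Icc_left (hτ.1.trans ht.1)))
  have left {g : ℝ → V} (hg : ∀ t ∈ Icc a b, HasDerivWithinAt g (f t (g t)) (Icc a b) t)
      (t) (ht : t ∈ Ioc a τ) : HasDerivWithinAt g (f t (g t)) (Iic t) t :=
    (hg t ⟨ht.1.le, ht.2.trans hτ.2⟩).mono_of_mem_nhdsWithin
      (mem_of_superset (Icc_mem_nhdsLE ht.1) (Icc_subset_Icc_right (ht.2.trans hτ.2)))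
  have subl : Icc a τ ⊆ Icc a b := Icc_subset_Icc_right hτ.2
  have subr : Icc τ b ⊆ Icc a b := Icc_subset_Icc_left hτ.1
  rw [← Icc_union_Icc_eq_Icc hτ.1 hτ.2]
  refine EqOn.union ?_ ?_
  · exact ODE_solution_unique_of_mem_Icc_left (v := f) (s := fun _ => s) (K := K)
      (fun t ht => hf t (subl (Ioc_subset_Icc_self ht))) ((cont hγ).mono subl) (left hγ)
      (fun t ht => hγs t (subl (Ioc_subset_Icc_self ht))) ((cont hη).mono subl) (left hη)
      (fun t ht => hηs t (subl (Ioc_subset_Icc_self ht))) h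
  · exact ODE_solution_unique_of_mem_Icc_right (v := f) (s := fun _ => s) (K := K)
      (fun t ht => hf t (subr (Ico_subset_Icc_self ht))) ((cont hγ).mono subr) (right hγ)
      (fun t ht => hγs t (subr (Ico_subset_Icc_self ht))) ((cont hη).mono subr) (right hη)
      (fun t ht => hηs t (subr (Ico_subset_Icc_self ht))) h

namespace IsAxisDominated

variable {F : ℝ → E × H → E × H} {h₀ : H} {δ : ℝ}

variable [FiniteDimensional ℝ E] [FiniteDimensional ℝ H]

/-- A closed ball about `z = (x, h)` of radius `3 / 4 * ‖x‖` is compact and avoids the axis, so that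
the field is Lipschitz on it, uniformly in time. -/
theorem exists_lipschitzOnWith (hF : IsAxisDominated F h₀ δ) {z : E × H}
    (hz : z ∈ ball ((0, h₀) : E × H) (δ / 2)) (hz0 : z.1 ≠ 0) :
    ∃ K : ℝ≥0, ∀ s ∈ Icc (0 : ℝ) 1,
      LipschitzOnWith K (F s) (closedBall z (3 / 4 * ‖z.1‖)) := by
  have : ProperSpace (E × H) := FiniteDimensional.proper ℝ _
  set B := closedBall z (3 / 4 * ‖z.1‖) with hB
  have hd : ∀ p ∈ Icc (0 : ℝ) 1 ×ˢ B, ContDiffAt ℝ 1 (uncurry F) p := fun p hp =>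
    hF.contDiffAt p.1 hp.1 p.2 (closedBall_subset_ball_of_half hz hp.2)
      (fst_ne_zero_of_mem_closedBall hz0 hp.2)
  have hcomp : IsCompact (Icc (0 : ℝ) 1 ×ˢ B) := isCompact_Icc.prod (isCompact_closedBall _ _)
  have hl : LocallyLipschitzOn (Icc (0 : ℝ) 1 ×ˢ B) (uncurry F) := fun p hp => by
    obtain ⟨K, t, ht, h⟩ := (hd p hp).exists_lipschitzOnWith
    exact ⟨K, t, mem_nhdsWithin_of_mem_nhds ht, h⟩
  obtain ⟨K, hK⟩ := hl.exists_lipschitzOnWith_of_compact hcomp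
  refine ⟨K, fun s hs => LipschitzOnWith.of_dist_le_mul fun x hx y hy => ?_⟩
  have := hK.dist_le_mul (s, x) ⟨hs, hx⟩ (s, y) ⟨hs, hy⟩
  simpa [uncurry, Prod.dist_eq] using this

/-- One application of the Picard-Lindelöf theorem covers the whole time interval `[0, 1]`: the ball
of radius `‖x‖ / 4` about `(x, h)` is small enough to avoid the axis, and large enough to contain the
trajectories. -/
theorem isPicardLindelof (hF : IsAxisDominated F h₀ δ) (τ : Icc (0 : ℝ) 1) {z : E × H}
    (hz : z ∈ ball ((0, h₀) : E × H) (δ / 2)) (hz0 : z.1 ≠ 0) :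
    ∃ K, IsPicardLindelof F τ z (‖z.1‖₊ / 4) (‖z.1‖₊ / 16) (3 * ‖z.1‖₊ / 16) K := by
  obtain ⟨K, hK⟩ := hF.exists_lipschitzOnWith hz hz0
  have hsub : closedBall z (‖z.1‖₊ / 4 : ℝ≥0) ⊆ closedBall z (3 / 4 * ‖z.1‖) := by
    refine closedBall_subset_closedBall ?_
    have := norm_nonneg z.1
    push_cast
    linarith
  refine ⟨K, fun s hs => (hK s hs).mono hsub, fun w hw s hs => ?_, fun s hs w hw => ?_, ?_⟩
  · have h1 := (hF.contDiffAt s hs w (closedBall_subset_ball_of_half hz (hsub hw))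
      (fst_ne_zero_of_mem_closedBall hz0 (hsub hw))).continuousAt
    exact (h1.comp (f := fun s => (s, w)) (by fun_prop)).continuousWithinAt
  · refine (hF.norm_le s hs w (closedBall_subset_ball_of_half hz (hsub hw))).trans ?_
    have h1 := (norm_fst_le (w - z)).trans (mem_closedBall_iff_norm.1 hw)
    have h2 : ‖w.1‖ ≤ ‖z.1‖ + ‖(w - z).1‖ := by
      have := norm_add_le z.1 (w - z).1
      simpa using this
    have := norm_nonneg z.1
    push_cast at h1 ⊢
    linarith
  · have h1 : max (1 - (τ : ℝ)) (τ - 0) ≤ 1 := max_le (by linarith [τ.2.1]) (by linarith [τ.2.2])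
    push_cast
    calc _ ≤ 3 * ‖z.1‖ / 16 * 1 := by gcongr
      _ = _ := by ring

end IsAxisDominated

theorem IsTrajectory.mem_closedBall_three_quarters {F : ℝ → E × H → E × H} {τ s : ℝ} {z : E × H}
    {γ : ℝ → E × H} (hγ : IsTrajectory F τ z γ) (hs : s ∈ Icc (0 : ℝ) 1) :
    γ s ∈ closedBall z (3 / 4 * ‖z.1‖) :=
  closedBall_subset_closedBall (by linarith [norm_nonneg z.1]) (hγ.mem_closedBall s hs)

theorem IsTrajectory.fst_ne_zero {F : ℝ → E × H → E × H} {τ s : ℝ} {z : E × H} {γ : ℝ → E × H}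
    (hγ : IsTrajectory F τ z γ) (hz : z.1 ≠ 0) (hs : s ∈ Icc (0 : ℝ) 1) : (γ s).1 ≠ 0 :=
  fst_ne_zero_of_mem_closedBall hz (hγ.mem_closedBall_three_quarters hs)

theorem IsTrajectory.mem_ball {F : ℝ → E × H → E × H} {h₀ : H} {δ τ s : ℝ} {z : E × H}
    {γ : ℝ → E × H} (hγ : IsTrajectory F τ z γ) (hz : z ∈ ball ((0, h₀) : E × H) (δ / 2))
    (hs : s ∈ Icc (0 : ℝ) 1) : γ s ∈ ball ((0, h₀) : E × H) δ :=
  closedBall_subset_ball_of_half hz (hγ.mem_closedBall_three_quarters hs)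

/-- A trajectory based at a point of another one coincides with it, whatever the two base times. -/
theorem IsTrajectory.eqOn_base [FiniteDimensional ℝ E] [FiniteDimensional ℝ H]
    {F : ℝ → E × H → E × H} {h₀ : H} {δ : ℝ}
    (hF : IsAxisDominated F h₀ δ) {τ σ : ℝ}
    (hσ : σ ∈ Icc (0 : ℝ) 1) {z : E × H} (hz : z ∈ ball ((0, h₀) : E × H) (δ / 2))
    {γ η : ℝ → E × H} (hγ : IsTrajectory F τ z γ) (hη : IsTrajectory F σ (γ σ) η) :
    EqOn γ η (Icc 0 1) := by
  rcases eq_or_ne z.1 0 with h0 | h0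
  · have h1 : ∀ s ∈ Icc (0 : ℝ) 1, γ s = z := fun s hs => by
      simpa [h0] using hγ.mem_closedBall s hs
    intro s hs
    have h2 : η s = z := by simpa [h1 σ hσ, h0] using hη.mem_closedBall s hs
    rw [h1 s hs, h2]
  · obtain ⟨K, hK⟩ := hF.exists_lipschitzOnWith hz h0
    -- Both curves stay in one ball off the axis: `1 / 4 + 1 / 4 * (1 + 1 / 4) ≤ 3 / 4`.
    have hp := norm_nonneg z.1
    refine eqOn_of_trajectories hK hσ hγ.hasDerivWithinAt hη.hasDerivWithinAt
      (fun s hs => hγ.mem_closedBall_three_quarters hs)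
      (fun s hs => ?_) hη.base.symm
    have h1 := mem_closedBall_iff_norm.1 (hγ.mem_closedBall σ hσ)
    have h2 := mem_closedBall_iff_norm.1 (hη.mem_closedBall s hs)
    have h3 := norm_fst_le (γ σ - z)
    have h4 : ‖(γ σ).1‖ ≤ ‖z.1‖ + ‖(γ σ - z).1‖ := by
      have := norm_add_le z.1 (γ σ - z).1
      simpa using this
    have h5 := norm_sub_le_norm_sub_add_norm_sub (η s) (γ σ) z
    rw [mem_closedBall_iff_norm]
    linarith

/-- A field dominated by the distance to the axis has a continuous flow over `[0, 1]` near
`(0, h₀)`, based at any time `τ`. Off the axis continuity is that of the Picard-Lindelöf flow; on the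
axis it follows from the bound `‖α z s - z‖ ≤ ‖x‖ / 4`. -/
theorem IsAxisDominated.exists_flow [FiniteDimensional ℝ E] [FiniteDimensional ℝ H]
    {F : ℝ → E × H → E × H} {h₀ : H} {δ : ℝ}
    (hF : IsAxisDominated F h₀ δ) (τ : Icc (0 : ℝ) 1) :
    ∃ α : E × H → ℝ → E × H,
      (∀ z ∈ ball ((0, h₀) : E × H) (δ / 2), IsTrajectory F τ z (α z)) ∧
      ∀ s ∈ Icc (0 : ℝ) 1, ContinuousOn (α · s) (ball ((0, h₀) : E × H) (δ / 2)) := by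
  have hc : CompleteSpace (E × H) := FiniteDimensional.complete ℝ _
  have ex (z : E × H) (hz : z ∈ ball ((0, h₀) : E × H) (δ / 2)) :
      ∃ γ, IsTrajectory F τ z γ := by
    rcases eq_or_ne z.1 0 with h0 | h0
    · refine ⟨fun _ => z, rfl, fun s hs => ?_, fun s _ => by simp [h0]⟩
      have h1 := hF.norm_le s hs z
        (closedBall_subset_ball_of_half hz (mem_closedBall_self (by positivity)))
      rw [h0, norm_zero, zero_div] at h1
      rw [norm_le_zero_iff.1 h1]
      exact hasDerivWithinAt_const _ _ _
    · obtain ⟨K, hK⟩ := hF.isPicardLindelof τ hz h0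
      obtain ⟨α, hα, -⟩ := exists_flow_mem_closedBall hK
      obtain ⟨h1, h2, h3⟩ := hα z (mem_closedBall_self (by positivity))
      exact ⟨α z, h1, h2, fun s _ => by simpa using h3 s⟩
  choose! α hα using ex
  refine ⟨α, hα, fun s hs z hz => ContinuousAt.continuousWithinAt ?_⟩
  rcases eq_or_ne z.1 0 with h0 | h0
  · have h1 : α z s = z := by
      simpa [h0] using (hα z hz).mem_closedBall s hs
    rw [ContinuousAt, h1]
    have h2 : Tendsto (fun w : E × H => ‖w.1‖ / 4) (𝓝 z) (𝓝 0) :=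
      Continuous.tendsto' (by fun_prop) _ _ (by simp [h0])
    have h3 : Tendsto (fun w => α w s - w) (𝓝 z) (𝓝 0) := by
      refine squeeze_zero_norm' ?_ h2
      filter_upwards [isOpen_ball.mem_nhds hz] with w hw
      exact mem_closedBall_iff_norm.1 ((hα w hw).mem_closedBall s hs)
    simpa using h3.add (tendsto_id (α := E × H) (x := 𝓝 z))
  · obtain ⟨K, hK⟩ := hF.isPicardLindelof τ hz h0
    obtain ⟨β, hβ, L', hL⟩ := exists_flow_mem_closedBall hK
    have hp := norm_pos_iff.2 h0
    have hr : closedBall z (‖z.1‖₊ / 16 : ℝ≥0) ∈ 𝓝 z := closedBall_mem_nhds _ (by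
      push_cast
      linarith)
    obtain ⟨K', hK'⟩ := hF.exists_lipschitzOnWith hz h0
    have heq : (β · s) =ᶠ[𝓝 z] (α · s) := by
      filter_upwards [hr, isOpen_ball.mem_nhds hz] with w hw hw'
      obtain ⟨h1, h2, h3⟩ := hβ w hw
      refine eqOn_of_trajectories hK' τ.2 h2 (hα w hw').hasDerivWithinAt
        (fun t _ => closedBall_subset_closedBall ?_ (h3 t)) (fun t ht => ?_)
        (h1.trans (hα w hw').base.symm) hs
      · push_cast
        linarith
      · have h4 := mem_closedBall_iff_norm.1 ((hα w hw').mem_closedBall t ht)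
        have h5 := mem_closedBall_iff_norm.1 hw
        have h6 := norm_fst_le (w - z)
        have h7 : ‖w.1‖ ≤ ‖z.1‖ + ‖(w - z).1‖ := by
          have := norm_add_le z.1 (w - z).1
          simpa using this
        have h8 := norm_sub_le_norm_sub_add_norm_sub (α w t) w z
        rw [mem_closedBall_iff_norm]
        push_cast at h5
        linarith
    exact ((hL s hs).continuousOn.continuousAt hr).congr heq

end AxisDominated

/-! ### Calculus of matrix products and partial homeomorphisms -/

theorem hasDerivWithinAt_mul_apply {𝕜 : Type*} [RCLike 𝕜] {l m n : Type*} [Fintype m]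
    {A : ℝ → Matrix l m 𝕜} {B : ℝ → Matrix m n 𝕜} {A' : Matrix l m 𝕜} {B' : Matrix m n 𝕜}
    {u : Set ℝ} {s : ℝ}
    (hA : ∀ i j, HasDerivWithinAt (fun σ => A σ i j) (A' i j) u s)
    (hB : ∀ i j, HasDerivWithinAt (fun σ => B σ i j) (B' i j) u s) (i : l) (j : n) :
    HasDerivWithinAt (fun σ => (A σ * B σ) i j) ((A' * B s + A s * B') i j) u s := by
  simp only [Matrix.add_apply, Matrix.mul_apply, ← Finset.sum_add_distrib]
  exact HasDerivWithinAt.fun_sum fun k _ => (hA i k).mul (hB k j)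

/-- If `N' = t (N P + Q N)`, then the solutions of `C' = -t C Q` and `B' = -t P B` are such that
`C N B` is constant. -/
theorem mul_mul_eq_of_hasDerivWithinAt {𝕜 : Type*} [RCLike 𝕜] {n p : ℕ} {t : 𝕜}
    {C Q : ℝ → Matrix (Fin n) (Fin n) 𝕜} {N : ℝ → Matrix (Fin n) (Fin p) 𝕜}
    {B P : ℝ → Matrix (Fin p) (Fin p) 𝕜}
    (hC : ∀ s ∈ Icc (0 : ℝ) 1, ∀ i j,
      HasDerivWithinAt (fun σ => C σ i j) ((-t • (C s * Q s)) i j) (Icc 0 1) s)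
    (hN : ∀ s ∈ Icc (0 : ℝ) 1, ∀ i j,
      HasDerivWithinAt (fun σ => N σ i j) ((t • (N s * P s + Q s * N s)) i j) (Icc 0 1) s)
    (hB : ∀ s ∈ Icc (0 : ℝ) 1, ∀ i j,
      HasDerivWithinAt (fun σ => B σ i j) ((-t • (P s * B s)) i j) (Icc 0 1) s) :
    C 1 * N 1 * B 1 = C 0 * N 0 * B 0 := by
  ext i j
  have key : ∀ s ∈ Icc (0 : ℝ) 1,
      HasDerivWithinAt (fun σ => (C σ * N σ * B σ) i j) 0 (Icc 0 1) s := fun s hs => by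
    have h := hasDerivWithinAt_mul_apply (hasDerivWithinAt_mul_apply (hC s hs) (hN s hs))
      (hB s hs) i j
    convert h using 1
    suffices h0 : ((-t • (C s * Q s)) * N s + C s * (t • (N s * P s + Q s * N s))) * B s
        + C s * N s * (-t • (P s * B s)) = 0 by
      rw [h0, Matrix.zero_apply]
    simp only [neg_smul, Matrix.smul_mul, Matrix.mul_smul, Matrix.mul_add, Matrix.add_mul,
      Matrix.neg_mul, Matrix.mul_neg, smul_add, Matrix.mul_assoc]
    abel
  exact constant_of_has_deriv_right_zero (fun s hs => (key s hs).continuousWithinAt)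
    (fun s hs => (key s (Ico_subset_Icc_self hs)).mono_of_mem_nhdsWithin
      (mem_of_superset (Icc_mem_nhdsGE hs.2) (Icc_subset_Icc_left hs.1)))
    1 (right_mem_Icc.2 zero_le_one)

/-- Two continuous maps `f`, `g` on an open set `D` that are inverse to each other as long as one stays
in `D` form a partial homeomorphism, from `D ∩ f ⁻¹' D` to `D ∩ g ⁻¹' D`. -/
def homeomorphOfInverse {X : Type*} [TopologicalSpace X] {D : Set X} (hD : IsOpen D)
    {f g : X → X} (hf : ContinuousOn f D) (hg : ContinuousOn g D)
    (hgf : ∀ q ∈ D, f q ∈ D → g (f q) = q) (hfg : ∀ q ∈ D, g q ∈ D → f (g q) = q) :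
    OpenPartialHomeomorph X X where
  toFun := f
  invFun := g
  source := D ∩ f ⁻¹' D
  target := D ∩ g ⁻¹' D
  map_source' q hq := ⟨hq.2, by
    rw [mem_preimage, hgf q hq.1 hq.2]
    exact hq.1⟩
  map_target' q hq := ⟨hq.2, by
    rw [mem_preimage, hfg q hq.1 hq.2]
    exact hq.1⟩
  left_inv' q hq := hgf q hq.1 hq.2
  right_inv' q hq := hfg q hq.1 hq.2
  open_source := hf.isOpen_inter_preimage hD hD
  open_target := hg.isOpen_inter_preimage hD hD
  continuousOn_toFun := hf.mono inter_subset_left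
  continuousOn_invFun := hg.mono inter_subset_left

/-! ### The differential equation along the rays of the parameter space -/

/-- The requirements at `q = (x, t)` on a vector field `V + ∂/∂t` and on matrices `Q`, `P` that lift
the parameter direction to the family `M`: all three are of class `C¹` off the axis `x = 0` and
bounded by `K ‖x‖`, and the derivative of `M` along `V + ∂/∂t` is `M P + Q M`. -/
structure IsLiftingData {𝕜 : Type*} [RCLike 𝕜] {r n p : ℕ}
    (M : Space 𝕜 r × 𝕜 → Matrix (Fin n) (Fin p) 𝕜) (V : Space 𝕜 r × 𝕜 → Space 𝕜 r)
    (Q : Space 𝕜 r × 𝕜 → Matrix (Fin n) (Fin n) 𝕜)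
    (P : Space 𝕜 r × 𝕜 → Matrix (Fin p) (Fin p) 𝕜) (K : ℝ) (q : Space 𝕜 r × 𝕜) : Prop where
  differentiableAt : ∀ i j, DifferentiableAt 𝕜 (fun q => M q i j) q
  contDiffAt_field : q.1 ≠ 0 → ContDiffAt ℝ 1 V q
  contDiffAt_row : q.1 ≠ 0 → ∀ i j, ContDiffAt ℝ 1 (fun q => Q q i j) q
  contDiffAt_col : q.1 ≠ 0 → ∀ i j, ContDiffAt ℝ 1 (fun q => P q i j) q
  norm_field_le : ‖V q‖ ≤ K * ‖q.1‖
  norm_row_le : ∀ i j, ‖Q q i j‖ ≤ K * ‖q.1‖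
  norm_col_le : ∀ i j, ‖P q i j‖ ≤ K * ‖q.1‖
  fderiv_apply : q.1 ≠ 0 → ∀ i j,
    fderiv 𝕜 (fun q => M q i j) q (V q, 1) = (M q * P q + Q q * M q) i j

section Ray

variable {𝕜 : Type*} [RCLike 𝕜] {r n p : ℕ}

/-- The vector field whose trajectories over `[0, 1]` are the curves `s ↦ (y s, t)` such that
`s ↦ (y s, s t)` has velocity `t (V + ∂/∂t)`; the latter lie above the segment from `0` to `t`.
Moving along segments from the origin treats a complex parameter like a real one. The parameter `t`
is part of the state, so that continuous dependence on `t` is a case of that on the initial point. -/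
def rayField (V : Space 𝕜 r × 𝕜 → Space 𝕜 r) (s : ℝ) (z : Space 𝕜 r × 𝕜) : Space 𝕜 r × 𝕜 :=
  (z.2 • V (z.1, s • z.2), 0)

/-- Triples `(t, c, b)` of a parameter and two square matrices. The matrices are plain functions,
with the sup norm, since `Matrix` carries no global norm. -/
abbrev FrameSpace (𝕜 : Type*) (n p : ℕ) : Type _ :=
  𝕜 × (Fin n → Fin n → 𝕜) × (Fin p → Fin p → 𝕜)

/-- The parameter `t` with two identity matrices. These are written as functions: the numeral `1`
in a function type is a constant function. -/
def idFrame (t : 𝕜) : FrameSpace 𝕜 n p :=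
  (t, fun i j => (1 : Matrix (Fin n) (Fin n) 𝕜) i j, fun i j => (1 : Matrix (Fin p) (Fin p) 𝕜) i j)

/-- The field `rayField` together with the linear equations `c' = -t c Q` and `b' = -t P b` along its
trajectories. -/
def frameRayField (V : Space 𝕜 r × 𝕜 → Space 𝕜 r)
    (Q : Space 𝕜 r × 𝕜 → Matrix (Fin n) (Fin n) 𝕜)
    (P : Space 𝕜 r × 𝕜 → Matrix (Fin p) (Fin p) 𝕜) (s : ℝ)
    (z : Space 𝕜 r × FrameSpace 𝕜 n p) : Space 𝕜 r × FrameSpace 𝕜 n p :=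
  (z.2.1 • V (z.1, s • z.2.1), 0,
    fun i j => -z.2.1 * ∑ k, z.2.2.1 i k * Q (z.1, s • z.2.1) k j,
    fun i j => -z.2.1 * ∑ k, P (z.1, s • z.2.1) i k * z.2.2.2 k j)

/-- The projection of `(x, (t, c, b))` to `(x, t)`. -/
def forgetFrame (z : Space 𝕜 r × FrameSpace 𝕜 n p) : Space 𝕜 r × 𝕜 := (z.1, z.2.1)

theorem mem_ball_ray {δ s : ℝ} (hs : s ∈ Icc (0 : ℝ) 1) {x : Space 𝕜 r} {t : 𝕜}
    (hx : ‖x‖ < δ) (ht : ‖t‖ < δ) : (x, s • t) ∈ ball (0 : Space 𝕜 r × 𝕜) δ := by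
  rw [mem_ball_zero_iff, Prod.norm_def, max_lt_iff]
  refine ⟨hx, ?_⟩
  rw [norm_smul, Real.norm_of_nonneg hs.1]
  exact (mul_le_of_le_one_left (norm_nonneg _) hs.2).trans_lt ht

variable {M : Space 𝕜 r × 𝕜 → Matrix (Fin n) (Fin p) 𝕜} {V : Space 𝕜 r × 𝕜 → Space 𝕜 r}
  {Q : Space 𝕜 r × 𝕜 → Matrix (Fin n) (Fin n) 𝕜}
  {P : Space 𝕜 r × 𝕜 → Matrix (Fin p) (Fin p) 𝕜} {K δ : ℝ}

theorem norm_mul_sum_le {m : ℕ} {t : 𝕜} {f g : Fin m → 𝕜} {c : ℝ} (ht : ‖t‖ ≤ δ)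
    (hf : ∀ k, ‖f k‖ ≤ 2) (hg : ∀ k, ‖g k‖ ≤ c) :
    ‖t * ∑ k, f k * g k‖ ≤ δ * (m * (2 * c)) := by
  rw [norm_mul]
  refine mul_le_mul ht ?_ (norm_nonneg _) ((norm_nonneg _).trans ht)
  refine (norm_sum_le_of_le _ fun k _ => ?_).trans_eq
    (by rw [Finset.sum_const, Finset.card_univ, Fintype.card_fin, nsmul_eq_mul])
  rw [norm_mul]
  exact mul_le_mul (hf k) (hg k) (norm_nonneg _) zero_le_two

theorem norm_apply_le_two {m : ℕ} {c : Fin m → Fin m → 𝕜}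
    (hc : ‖c - fun i j => (1 : Matrix (Fin m) (Fin m) 𝕜) i j‖ < 1) (i j : Fin m) :
    ‖c i j‖ ≤ 2 := by
  have h1 := (norm_le_pi_norm (c - fun i j => (1 : Matrix (Fin m) (Fin m) 𝕜) i j) i)
  have h2 := (norm_le_pi_norm ((c - fun i j => (1 : Matrix (Fin m) (Fin m) 𝕜) i j) i) j)
  have h3 : ‖(1 : Matrix (Fin m) (Fin m) 𝕜) i j‖ ≤ 1 := by
    rw [Matrix.one_apply]
    split_ifs <;> simp
  have h4 := norm_add_le (c i j - (1 : Matrix (Fin m) (Fin m) 𝕜) i j)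
    ((1 : Matrix (Fin m) (Fin m) 𝕜) i j)
  rw [sub_add_cancel] at h4
  simp only [Pi.sub_apply] at h1 h2
  linarith

theorem isAxisDominated_frameRayField (hδ1 : δ ≤ 1) (hK : 0 ≤ K)
    (hδ : δ * (K * (1 + 2 * n + 2 * p)) ≤ 1 / 8)
    (h : ∀ q ∈ ball (0 : Space 𝕜 r × 𝕜) δ, IsLiftingData M V Q P K q) :
    IsAxisDominated (frameRayField V Q P) (idFrame 0) δ := by
  have split {z : Space 𝕜 r × FrameSpace 𝕜 n p}
      (hz : z ∈ ball ((0, idFrame 0) : Space 𝕜 r × FrameSpace 𝕜 n p) δ) :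
      ‖z.1‖ < δ ∧ ‖z.2.1‖ < δ ∧
      ‖z.2.2.1 - fun i j => (1 : Matrix (Fin n) (Fin n) 𝕜) i j‖ < δ ∧
      ‖z.2.2.2 - fun i j => (1 : Matrix (Fin p) (Fin p) 𝕜) i j‖ < δ := by
    rw [mem_ball_iff_norm] at hz
    simpa [Prod.norm_def, idFrame] using hz
  refine ⟨fun s hs z hz hz0 => ?_, fun s hs z hz => ?_⟩
  · obtain ⟨h1, h2, -, -⟩ := split hz
    have hq := h _ (mem_ball_ray hs h1 h2)
    have hray : ContDiffAt ℝ 1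
        (fun w : ℝ × Space 𝕜 r × FrameSpace 𝕜 n p => (w.2.1, w.1 • w.2.2.1)) (s, z) := by
      fun_prop
    have hV : ContDiffAt ℝ 1 (fun w : ℝ × Space 𝕜 r × FrameSpace 𝕜 n p =>
        V (w.2.1, w.1 • w.2.2.1)) (s, z) := (hq.contDiffAt_field hz0).comp (s, z) hray
    have hQ (i j) : ContDiffAt ℝ 1 (fun w : ℝ × Space 𝕜 r × FrameSpace 𝕜 n p =>
        Q (w.2.1, w.1 • w.2.2.1) i j) (s, z) :=
      ContDiffAt.comp (g := fun q => Q q i j) (s, z) (hq.contDiffAt_row hz0 i j) hray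
    have hP (i j) : ContDiffAt ℝ 1 (fun w : ℝ × Space 𝕜 r × FrameSpace 𝕜 n p =>
        P (w.2.1, w.1 • w.2.2.1) i j) (s, z) :=
      ContDiffAt.comp (g := fun q => P q i j) (s, z) (hq.contDiffAt_col hz0 i j) hray
    have ht : ContDiffAt ℝ 1 (fun w : ℝ × Space 𝕜 r × FrameSpace 𝕜 n p => w.2.2.1) (s, z) := by
      fun_prop
    have hc (i j) : ContDiffAt ℝ 1
        (fun w : ℝ × Space 𝕜 r × FrameSpace 𝕜 n p => w.2.2.2.1 i j) (s, z) := by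
      fun_prop
    have hb (i j) : ContDiffAt ℝ 1
        (fun w : ℝ × Space 𝕜 r × FrameSpace 𝕜 n p => w.2.2.2.2 i j) (s, z) := by
      fun_prop
    refine (ht.smul hV).prodMk (contDiffAt_const.prodMk (ContDiffAt.prodMk ?_ ?_))
    · refine contDiffAt_pi.2 fun i => contDiffAt_pi.2 fun j => ?_
      exact ht.neg.mul (ContDiffAt.sum fun k _ => (hc i k).mul (hQ k j))
    · refine contDiffAt_pi.2 fun i => contDiffAt_pi.2 fun j => ?_
      exact ht.neg.mul (ContDiffAt.sum fun k _ => (hP i k).mul (hb k j))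
  · obtain ⟨h1, h2, h3, h4⟩ := split hz
    have hq := h _ (mem_ball_ray hs h1 h2)
    have hδ0 : 0 ≤ δ := (norm_nonneg _).trans h1.le
    have hx := norm_nonneg z.1
    have hmain := mul_le_mul_of_nonneg_right hδ hx
    have hn : 0 ≤ δ * (K * n * ‖z.1‖) := by positivity
    have hp : 0 ≤ δ * (K * p * ‖z.1‖) := by positivity
    have hk : 0 ≤ δ * (K * ‖z.1‖) := by positivity
    simp only [frameRayField, Prod.norm_def, max_le_iff, norm_zero]
    refine ⟨?_, by positivity, ?_, ?_⟩
    · rw [norm_smul]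
      have := mul_le_mul h2.le hq.norm_field_le (norm_nonneg _) hδ0
      simp only at this
      linarith
    · refine (pi_norm_le_iff_of_nonneg (by positivity)).2 fun i =>
        (pi_norm_le_iff_of_nonneg (by positivity)).2 fun j => ?_
      have := norm_mul_sum_le ((norm_neg z.2.1).trans_le h2.le)
        (norm_apply_le_two (h3.trans_le hδ1) i) (fun k => hq.norm_row_le k j)
      simp only at this
      linarith
    · refine (pi_norm_le_iff_of_nonneg (by positivity)).2 fun i =>
        (pi_norm_le_iff_of_nonneg (by positivity)).2 fun j => ?_
      have := norm_mul_sum_le ((norm_neg z.2.1).trans_le h2.le)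
        (fun k => norm_apply_le_two (h4.trans_le hδ1) k j) (fun k => hq.norm_col_le i k)
      simp only [mul_comm (z.2.2.2 _ _)] at this
      linarith

theorem isAxisDominated_rayField (hK : 0 ≤ K) (hδ : δ * (K * (1 + 2 * n + 2 * p)) ≤ 1 / 8)
    (h : ∀ q ∈ ball (0 : Space 𝕜 r × 𝕜) δ, IsLiftingData M V Q P K q) :
    IsAxisDominated (rayField V) 0 δ := by
  have split {z : Space 𝕜 r × 𝕜} (hz : z ∈ ball ((0, 0) : Space 𝕜 r × 𝕜) δ) :
      ‖z.1‖ < δ ∧ ‖z.2‖ < δ := by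
    rw [mem_ball_iff_norm] at hz
    simpa [Prod.norm_def] using hz
  refine ⟨fun s hs z hz hz0 => ?_, fun s hs z hz => ?_⟩
  · obtain ⟨h1, h2⟩ := split hz
    have hq := h _ (mem_ball_ray hs h1 h2)
    have hray : ContDiffAt ℝ 1
        (fun w : ℝ × Space 𝕜 r × 𝕜 => (w.2.1, w.1 • w.2.2)) (s, z) := by
      fun_prop
    have hV : ContDiffAt ℝ 1 (fun w : ℝ × Space 𝕜 r × 𝕜 =>
        V (w.2.1, w.1 • w.2.2)) (s, z) := (hq.contDiffAt_field hz0).comp (s, z) hray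
    have ht : ContDiffAt ℝ 1 (fun w : ℝ × Space 𝕜 r × 𝕜 => w.2.2) (s, z) := by
      fun_prop
    exact (ht.smul hV).prodMk contDiffAt_const
  · obtain ⟨h1, h2⟩ := split hz
    have hq := h _ (mem_ball_ray hs h1 h2)
    have hδ0 : 0 ≤ δ := (norm_nonneg _).trans h1.le
    have hx := norm_nonneg z.1
    have hmain := mul_le_mul_of_nonneg_right hδ hx
    have hn : 0 ≤ δ * (K * n * ‖z.1‖) := by positivity
    have hp : 0 ≤ δ * (K * p * ‖z.1‖) := by positivity
    simp only [rayField, Prod.norm_def, max_le_iff, norm_zero]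
    refine ⟨?_, by positivity⟩
    rw [norm_smul]
    have := mul_le_mul h2.le hq.norm_field_le (norm_nonneg _) hδ0
    simp only at this
    linarith

/-- The matrix components of a trajectory can be dropped: they do not influence the others. -/
theorem IsTrajectory.forgetFrame {τ : ℝ} {z : Space 𝕜 r × FrameSpace 𝕜 n p}
    {γ : ℝ → Space 𝕜 r × FrameSpace 𝕜 n p} (hγ : IsTrajectory (frameRayField V Q P) τ z γ) :
    IsTrajectory (rayField V) τ (forgetFrame z) (fun s => forgetFrame (γ s)) where
  base := by rw [hγ.base]
  hasDerivWithinAt s hs := (hγ.hasDerivWithinAt s hs).fst.prodMk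
    (hγ.hasDerivWithinAt s hs).snd.fst
  mem_closedBall s hs := by
    have h1 := mem_closedBall_iff_norm.1 (hγ.mem_closedBall s hs)
    rw [mem_closedBall_iff_norm]
    refine le_trans (max_le ?_ ?_) h1
    · exact norm_fst_le (γ s - z)
    · exact (norm_fst_le (γ s - z).2).trans (norm_snd_le (γ s - z))

/-- The parameter is constant along the trajectories. -/
theorem IsTrajectory.snd_eq {τ : ℝ} (hτ : τ ∈ Icc (0 : ℝ) 1) {z : Space 𝕜 r × 𝕜}
    {γ : ℝ → Space 𝕜 r × 𝕜} (hγ : IsTrajectory (rayField V) τ z γ) {s : ℝ}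
    (hs : s ∈ Icc (0 : ℝ) 1) : (γ s).2 = z.2 := by
  have h (σ) (hσ : σ ∈ Icc (0 : ℝ) 1) :
      HasDerivWithinAt (fun σ => (γ σ).2) 0 (Icc 0 1) σ := (hγ.hasDerivWithinAt σ hσ).snd
  have h1 := constant_of_has_deriv_right_zero (fun σ hσ => (h σ hσ).continuousWithinAt)
    (fun σ hσ => (h σ (Ico_subset_Icc_self hσ)).mono_of_mem_nhdsWithin
      (mem_of_superset (Icc_mem_nhdsGE hσ.2) (Icc_subset_Icc_left hσ.1)))
  rw [h1 s hs, ← h1 τ hτ, hγ.base]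

end Ray

/-! ### Triviality from a lifting vector field -/

section Triviality

variable {𝕜 : Type*} [RCLike 𝕜] {r n p : ℕ}
  {M : Space 𝕜 r × 𝕜 → Matrix (Fin n) (Fin p) 𝕜} {V : Space 𝕜 r × 𝕜 → Space 𝕜 r}
  {Q : Space 𝕜 r × 𝕜 → Matrix (Fin n) (Fin n) 𝕜}
  {P : Space 𝕜 r × 𝕜 → Matrix (Fin p) (Fin p) 𝕜} {K δ : ℝ}

/-- The point `(x, t)` together with two identity matrices. -/
def withIdFrame (q : Space 𝕜 r × 𝕜) : Space 𝕜 r × FrameSpace 𝕜 n p := (q.1, idFrame q.2)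

theorem continuous_withIdFrame :
    Continuous (withIdFrame : Space 𝕜 r × 𝕜 → Space 𝕜 r × FrameSpace 𝕜 n p) := by
  unfold withIdFrame idFrame
  fun_prop

theorem withIdFrame_mem_ball {q : Space 𝕜 r × 𝕜} (hq : q ∈ ball (0 : Space 𝕜 r × 𝕜) δ) :
    withIdFrame q ∈ ball ((0, idFrame 0) : Space 𝕜 r × FrameSpace 𝕜 n p) δ := by
  rw [mem_ball_iff_norm] at hq ⊢
  simpa [Prod.norm_def, withIdFrame, idFrame, (norm_nonneg _).trans_lt hq] using hq

/-- The chain rule for the family along a real curve of velocity `t (V + ∂/∂t)`. Here `t` may be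
complex: the derivative of the family is `𝕜`-linear. -/
theorem hasDerivWithinAt_family {w : ℝ → Space 𝕜 r × 𝕜} {u : Set ℝ} {s : ℝ}
    {t : 𝕜} (hq : IsLiftingData M V Q P K (w s)) (h0 : (w s).1 ≠ 0)
    (hw : HasDerivWithinAt w (t • V (w s), t) u s) (i : Fin n) (j : Fin p) :
    HasDerivWithinAt (fun σ => M (w σ) i j)
      ((t • (M (w s) * P (w s) + Q (w s) * M (w s))) i j) u s := by
  have h1 := ((hq.differentiableAt i j).hasFDerivAt.restrictScalars ℝ).comp_hasDerivWithinAt s hw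
  refine h1.congr_deriv ?_
  have h2 : ((t • V (w s), t) : Space 𝕜 r × 𝕜) = t • (V (w s), 1) := by simp
  change fderiv 𝕜 (fun q => M q i j) (w s) (t • V (w s), t) = _
  rw [h2, map_smul, hq.fderiv_apply h0 i j]
  rfl

/-- Off the axis, the two frames transported to time `1` turn `M` at the end of a trajectory back
into `M` at its start. -/
theorem frame_mul_family_mul_frame
    (h : ∀ q ∈ ball (0 : Space 𝕜 r × 𝕜) δ, IsLiftingData M V Q P K q)
    {q : Space 𝕜 r × 𝕜} (hq : q ∈ ball (0 : Space 𝕜 r × 𝕜) (δ / 2)) (h0 : q.1 ≠ 0)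
    {γ : ℝ → Space 𝕜 r × FrameSpace 𝕜 n p}
    (hγ : IsTrajectory (frameRayField V Q P) 0 (withIdFrame q) γ) :
    Matrix.of (γ 1).2.2.1 * M (forgetFrame (γ 1)) * Matrix.of (γ 1).2.2.2 = M (q.1, 0) := by
  have hsnd (s) (hs : s ∈ Icc (0 : ℝ) 1) : (γ s).2.1 = q.2 :=
    hγ.forgetFrame.snd_eq (left_mem_Icc.2 zero_le_one) hs
  have hfst (s) (hs : s ∈ Icc (0 : ℝ) 1) : (γ s).1 ≠ 0 := hγ.fst_ne_zero h0 hs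
  have hray (s) (hs : s ∈ Icc (0 : ℝ) 1) :
      ((γ s).1, s • q.2) ∈ ball (0 : Space 𝕜 r × 𝕜) δ := by
    have h1 := norm_fst_lt_of_mem_ball (hγ.mem_ball (withIdFrame_mem_ball hq) hs)
    have h2 : ‖q.2‖ < δ / 2 := (norm_snd_le q).trans_lt (mem_ball_zero_iff.1 hq)
    exact mem_ball_ray hs h1 (by linarith [norm_nonneg q.2])
  have hderiv (s) (hs : s ∈ Icc (0 : ℝ) 1) := hγ.hasDerivWithinAt s hs
  have key := mul_mul_eq_of_hasDerivWithinAt (t := q.2)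
    (C := fun s => Matrix.of (γ s).2.2.1) (Q := fun s => Q ((γ s).1, s • q.2))
    (N := fun s => M ((γ s).1, s • q.2)) (B := fun s => Matrix.of (γ s).2.2.2)
    (P := fun s => P ((γ s).1, s • q.2)) ?_ ?_ ?_
  · have h1 : forgetFrame (γ 1) = ((γ 1).1, (1 : ℝ) • q.2) := by
      rw [one_smul, ← hsnd 1 (right_mem_Icc.2 zero_le_one)]
      rfl
    rw [h1, key, hγ.base, zero_smul]
    change (1 : Matrix (Fin n) (Fin n) 𝕜) * M (q.1, 0) * (1 : Matrix (Fin p) (Fin p) 𝕜) = _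
    rw [Matrix.one_mul, Matrix.mul_one]
  · intro s hs i j
    have h1 := hasDerivWithinAt_pi.1 (hasDerivWithinAt_pi.1 (hderiv s hs).snd.snd.fst i) j
    refine h1.congr_deriv ?_
    simp [frameRayField, hsnd s hs, Matrix.mul_apply]
  · intro s hs i j
    refine hasDerivWithinAt_family (w := fun s => ((γ s).1, s • q.2)) (h _ (hray s hs))
      (hfst s hs) ?_ i j
    have h1 : HasDerivWithinAt (fun σ => (γ σ).1) (q.2 • V ((γ s).1, s • q.2)) (Icc 0 1) s := by
      have h3 := (hderiv s hs).fst
      simp only [frameRayField, hsnd s hs] at h3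
      exact h3
    have h2 : HasDerivWithinAt (fun σ : ℝ => σ • q.2) q.2 (Icc 0 1) s := by
      simpa using ((hasDerivAt_id s).smul_const q.2).hasDerivWithinAt
    exact h1.prodMk h2
  · intro s hs i j
    have h1 := hasDerivWithinAt_pi.1 (hasDerivWithinAt_pi.1 (hderiv s hs).snd.snd.snd i) j
    refine h1.congr_deriv ?_
    simp [frameRayField, hsnd s hs, Matrix.mul_apply]

/-- Nothing moves above the parameter `0`. -/
theorem IsTrajectory.eq_of_snd_eq_zero {x : Space 𝕜 r} {γ : ℝ → Space 𝕜 r × FrameSpace 𝕜 n p}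
    (hγ : IsTrajectory (frameRayField V Q P) 0 (withIdFrame (x, 0)) γ) :
    γ 1 = withIdFrame (x, 0) := by
  have hd (s) (hs : s ∈ Icc (0 : ℝ) 1) : HasDerivWithinAt γ 0 (Icc 0 1) s := by
    have h1 : (γ s).2.1 = 0 := hγ.forgetFrame.snd_eq (left_mem_Icc.2 zero_le_one) hs
    convert hγ.hasDerivWithinAt s hs using 1
    simp only [frameRayField, h1, zero_smul, neg_zero, zero_mul]
    rfl
  rw [← hγ.base]
  exact constant_of_has_deriv_right_zero (fun s hs => (hd s hs).continuousWithinAt)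
    (fun s hs => (hd s (Ico_subset_Icc_self hs)).mono_of_mem_nhdsWithin
      (mem_of_superset (Icc_mem_nhdsGE hs.2) (Icc_subset_Icc_left hs.1)))
    1 (right_mem_Icc.2 zero_le_one)

theorem eventually_isUnit_matrix_of (m : ℕ) :
    ∀ᶠ c in 𝓝 (fun i j => (1 : Matrix (Fin m) (Fin m) 𝕜) i j : Fin m → Fin m → 𝕜),
      IsUnit (Matrix.of c) := by
  have h1 : Continuous fun c : Fin m → Fin m → 𝕜 => (Matrix.of c).det :=
    Continuous.matrix_det (A := fun c : Fin m → Fin m → 𝕜 => Matrix.of c) continuous_id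
  have h2 : (Matrix.of fun i j => (1 : Matrix (Fin m) (Fin m) 𝕜) i j).det ≠ 0 := by
    change (1 : Matrix (Fin m) (Fin m) 𝕜).det ≠ 0
    simp
  filter_upwards [h1.continuousAt.eventually_ne h2] with c hc
  exact (Matrix.isUnit_iff_isUnit_det _).2 hc.isUnit

theorem continuousOn_matrix_inv {X : Type*} [TopologicalSpace X] {u : Set X}
    {C : X → Matrix (Fin n) (Fin n) 𝕜} (hC : ContinuousOn C u) (h : ∀ q ∈ u, IsUnit (C q)) :
    ContinuousOn (fun q => (C q)⁻¹) u := by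
  simp only [Matrix.inv_def, Ring.inverse_eq_inv']
  have hdet : Continuous fun C : Matrix (Fin n) (Fin n) 𝕜 => C.det := continuous_id.matrix_det
  have hadj : Continuous fun C : Matrix (Fin n) (Fin n) 𝕜 => C.adjugate :=
    continuous_id.matrix_adjugate
  exact ((hdet.comp_continuousOn hC).inv₀ fun q hq =>
    ((Matrix.isUnit_iff_isUnit_det _).1 (h q hq)).ne_zero).smul (hadj.comp_continuousOn hC)

/-- The flow of lifting data trivializes the family. The homeomorphism is the time `1` flow along the
segments `[0, t]`, its inverse the flow from time `1` back to time `0`, and `A⁻¹`, `B` are the two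
transported frames. -/
theorem isC0GTrivial_of_liftingData [Nontrivial (Space 𝕜 r)]
    {M₀ : Space 𝕜 r → Matrix (Fin n) (Fin p) 𝕜} (hK : 0 ≤ K)
    (h : ∀ᶠ q in 𝓝 (0 : Space 𝕜 r × 𝕜), IsLiftingData M V Q P K q)
    (hM₀ : ∀ᶠ x in 𝓝 (0 : Space 𝕜 r), M (x, 0) = M₀ x) : IsC0GTrivial M₀ M := by
  have hM₀' : ∀ᶠ q in 𝓝 (0 : Space 𝕜 r × 𝕜), M (q.1, 0) = M₀ q.1 :=
    (continuous_fst.tendsto (0 : Space 𝕜 r × 𝕜)).eventually hM₀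
  obtain ⟨δ₁, hδ₁, h₁⟩ := Metric.eventually_nhds_iff_ball.1 (h.and hM₀')
  obtain ⟨δ₂, hδ₂, h₂⟩ := Metric.eventually_nhds_iff_ball.1 (eventually_isUnit_matrix_of (𝕜 := 𝕜) n)
  obtain ⟨δ₃, hδ₃, h₃⟩ := Metric.eventually_nhds_iff_ball.1 (eventually_isUnit_matrix_of (𝕜 := 𝕜) p)
  obtain ⟨δ, hδ, hδ1, hδδ₁, hδδ₂, hδδ₃, hδK⟩ : ∃ δ : ℝ, 0 < δ ∧ δ ≤ 1 ∧ δ ≤ δ₁ ∧ δ ≤ δ₂ ∧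
      δ ≤ δ₃ ∧ δ * (K * (1 + 2 * n + 2 * p)) ≤ 1 / 8 := by
    have hc : 0 ≤ K * (1 + 2 * n + 2 * p) := by positivity
    generalize K * (1 + 2 * n + 2 * p) = c at hc
    refine ⟨min (min 1 δ₁) (min (min δ₂ δ₃) (1 / (8 * (c + 1)))), by positivity, by simp, by simp,
      by simp, by simp, ?_⟩
    calc _ ≤ 1 / (8 * (c + 1)) * c := by
          gcongr
          simp
      _ ≤ 1 / 8 := by
          rw [div_mul_eq_mul_div, div_le_div_iff₀ (by positivity) (by norm_num)]
          linarith
  have hdata (q) (hq : q ∈ ball (0 : Space 𝕜 r × 𝕜) δ) : IsLiftingData M V Q P K q :=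
    (h₁ q (ball_subset_ball hδδ₁ hq)).1
  have hF := isAxisDominated_frameRayField hδ1 hK hδK hdata
  have hf := isAxisDominated_rayField hK hδK hdata
  obtain ⟨α, hα, hαc⟩ := hF.exists_flow ⟨0, left_mem_Icc.2 zero_le_one⟩
  obtain ⟨β, hβ, hβc⟩ := hf.exists_flow ⟨1, right_mem_Icc.2 zero_le_one⟩
  simp only [Prod.mk_zero_zero] at hβ hβc
  set D := ball (0 : Space 𝕜 r × 𝕜) (δ / 2) with hD
  have hI0 : (0 : ℝ) ∈ Icc (0 : ℝ) 1 := left_mem_Icc.2 zero_le_one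
  have hI1 : (1 : ℝ) ∈ Icc (0 : ℝ) 1 := right_mem_Icc.2 zero_le_one
  have hα' (q) (hq : q ∈ D) :
      IsTrajectory (frameRayField V Q P) 0 (withIdFrame q) (α (withIdFrame q)) :=
    hα (withIdFrame q) (withIdFrame_mem_ball hq)
  have hαf (q) (hq : q ∈ D) :
      IsTrajectory (rayField V) 0 q (fun s => forgetFrame (α (withIdFrame q) s)) :=
    (hα' q hq).forgetFrame
  have hcont : ContinuousOn (fun q => α (withIdFrame q) 1) D :=
    (hαc 1 hI1).comp continuous_withIdFrame.continuousOn fun q hq => withIdFrame_mem_ball hq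
  have hΦc : ContinuousOn (fun q => forgetFrame (α (withIdFrame q) 1)) D :=
    hcont.fst.prodMk hcont.snd.fst
  let Φ := homeomorphOfInverse (D := D) (f := fun q => forgetFrame (α (withIdFrame q) 1))
    (g := fun q => β q 0) isOpen_ball hΦc (hβc 0 hI0)
    (fun q hq hq' => (((hαf q hq).eqOn_base hf hI1 hq (hβ _ hq')) hI0).symm.trans
      (hαf q hq).base)
    (fun q hq hq' => (((hβ q hq).eqOn_base hf hI0 hq (hαf _ hq')) hI1).symm.trans (hβ q hq).base)
  have hΦ (q) : Φ q = forgetFrame (α (withIdFrame q) 1) := rfl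
  have hsrc : Φ.source ⊆ D := inter_subset_left
  have hΦD (q) (hq : q ∈ Φ.source) : Φ q ∈ D := hq.2
  have haxis (t : 𝕜) (ht : (0, t) ∈ D) :
      α (withIdFrame (0, t)) 1 = withIdFrame ((0, t) : Space 𝕜 r × 𝕜) := by
    have h1 := (hα' _ ht).mem_closedBall 1 hI1
    have h2 : (withIdFrame ((0, t) : Space 𝕜 r × 𝕜) : Space 𝕜 r × FrameSpace 𝕜 n p).1 = 0 := rfl
    rw [h2] at h1
    simpa using h1
  have hrestr (x : Space 𝕜 r) (hx : (x, 0) ∈ D) :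
      α (withIdFrame (x, 0)) 1 = withIdFrame (x, (0 : 𝕜)) := (hα' _ hx).eq_of_snd_eq_zero
  have hmem (q) (hq : q ∈ D) :
      α (withIdFrame q) 1 ∈ ball ((0, idFrame 0) : Space 𝕜 r × FrameSpace 𝕜 n p) δ :=
    (hα' q hq).mem_ball (withIdFrame_mem_ball hq) hI1
  have hunitC (q) (hq : q ∈ D) : IsUnit (Matrix.of (α (withIdFrame q) 1).2.2.1) := by
    refine h₂ _ (ball_subset_ball hδδ₂ ?_)
    have h1 := hmem q hq
    rw [mem_ball, Prod.dist_eq, Prod.dist_eq, Prod.dist_eq] at h1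
    simp only [max_lt_iff] at h1
    exact h1.2.2.1
  have hunitB (q) (hq : q ∈ D) : IsUnit (Matrix.of (α (withIdFrame q) 1).2.2.2) := by
    refine h₃ _ (ball_subset_ball hδδ₃ ?_)
    have h1 := hmem q hq
    rw [mem_ball, Prod.dist_eq, Prod.dist_eq, Prod.dist_eq] at h1
    simp only [max_lt_iff] at h1
    exact h1.2.2.2
  have hcontC : ContinuousOn (fun q => Matrix.of (α (withIdFrame q) 1).2.2.1) D :=
    hcont.snd.snd.fst
  have hcontB : ContinuousOn (fun q => Matrix.of (α (withIdFrame q) 1).2.2.2) D :=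
    hcont.snd.snd.snd
  have hMc : ContinuousOn M (ball 0 δ) := fun q hq => ContinuousAt.continuousWithinAt <|
    continuousAt_pi.2 fun i => continuousAt_pi.2 fun j =>
      ((hdata q hq).differentiableAt i j).continuousAt
  have hDδ : D ⊆ ball 0 δ := ball_subset_ball (by linarith)
  have hproj : MapsTo (fun q : Space 𝕜 r × 𝕜 => (q.1, (0 : 𝕜))) D D := fun q hq => by
    rw [hD, mem_ball_zero_iff] at hq ⊢
    simpa [Prod.norm_def] using (norm_fst_le q).trans_lt hq
  have hformula : EqOn
      (fun q => Matrix.of (α (withIdFrame q) 1).2.2.1 * M (Φ q) *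
        Matrix.of (α (withIdFrame q) 1).2.2.2)
      (fun q => M (q.1, 0)) Φ.source := by
    -- On the axis, where `M` is not controlled by the differential equation, the identity holds by
    -- continuity, since the axis has empty interior.
    refine EqOn.of_subset_closure (s := Φ.source ∩ {q | q.1 ≠ 0}) ?_ ?_ ?_ inter_subset_left ?_
    · intro q hq
      exact frame_mul_family_mul_frame hdata (hsrc hq.1) hq.2 (hα' q (hsrc hq.1))
    · have hMΦ : ContinuousOn (fun q => M (Φ q)) Φ.source :=
        hMc.comp (hΦc.mono hsrc) fun q hq => hDδ (hΦD q hq)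
      rw [continuousOn_iff_continuous_domRestrict] at hMΦ ⊢
      exact ((continuousOn_iff_continuous_domRestrict.1 (hcontC.mono hsrc)).matrix_mul hMΦ).matrix_mul
        (continuousOn_iff_continuous_domRestrict.1 (hcontB.mono hsrc))
    · exact hMc.comp (by fun_prop) fun q hq => hDδ (hproj (hsrc hq))
    · exact ((dense_compl_singleton (0 : Space 𝕜 r)).preimage isOpenMap_fst).open_subset_closure_inter
        Φ.open_source
  have h0D : (0 : Space 𝕜 r × 𝕜) ∈ D := mem_ball_self (by positivity)
  refine ⟨Φ, fun q => (Matrix.of (α (withIdFrame q) 1).2.2.1)⁻¹,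
    fun q => Matrix.of (α (withIdFrame q) 1).2.2.2, ⟨h0D, ?_⟩, fun q hq => ?_, fun x hx => ?_,
    fun t ht => ?_, ?_, hcontB.mono hsrc, fun q hq => ⟨?_, hunitB q (hsrc hq)⟩, fun x hx => ?_,
    fun q hq => ?_⟩
  · rw [mem_preimage]
    convert h0D
    exact congrArg forgetFrame (haxis 0 h0D)
  · exact (hαf q (hsrc hq)).snd_eq hI0 hI1
  · exact congrArg forgetFrame (hrestr x (hsrc hx))
  · exact congrArg forgetFrame (haxis t (hsrc ht))
  · exact continuousOn_matrix_inv (hcontC.mono hsrc) fun q hq => hunitC q (hsrc hq)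
  · exact Matrix.isUnit_nonsing_inv_iff.2 (hunitC q (hsrc hq))
  · simp only [hrestr x (hsrc hx)]
    change (1 : Matrix (Fin n) (Fin n) 𝕜)⁻¹ = 1 ∧ (1 : Matrix (Fin p) (Fin p) 𝕜) = 1
    simp
  · rw [Matrix.nonsing_inv_nonsing_inv _ ((Matrix.isUnit_iff_isUnit_det _).1 (hunitC q (hsrc hq))),
      ← (h₁ q (ball_subset_ball hδδ₁ (hDδ (hsrc hq)))).2]
    exact (hformula hq).symm

end Triviality

/-! ### The lifting vector field of an infinitesimally trivial deformation -/

section Germs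

variable {𝕜 : Type*} [RCLike 𝕜] {r n p : ℕ}

/-- The vector field `V = -∑ (ξᵢ / ρ²) ∂/∂xᵢ`. Where `ρ` vanishes, and so on the axis `x = 0`, the
convention `0⁻¹ = 0` gives it the value `0`, which is its continuous extension. -/
noncomputable def liftField (ρ : Space 𝕜 r × 𝕜 → ℝ) (ξ : Fin r → Space 𝕜 r × 𝕜 → 𝕜)
    (q : Space 𝕜 r × 𝕜) : Space 𝕜 r :=
  ∑ i, (-((ρ q ^ 2)⁻¹ • ξ i q)) • EuclideanSpace.single i (1 : 𝕜)

/-- The matrix `S / ρ²` that acts on the rows of the family, with value `0` where `ρ = 0`. -/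
noncomputable def rowCoeff (ρ : Space 𝕜 r × 𝕜 → ℝ) (S : Fin n → Fin n → Space 𝕜 r × 𝕜 → 𝕜)
    (q : Space 𝕜 r × 𝕜) : Matrix (Fin n) (Fin n) 𝕜 :=
  Matrix.of fun a b => (ρ q ^ 2)⁻¹ • S a b q

/-- The matrix that acts on the columns of the family by multiplication on the right, with value `0`
where `ρ = 0`. It is the transpose of `L / ρ²`, as `colMat l k` puts column `k` in place of column
`l`. -/
noncomputable def colCoeff (ρ : Space 𝕜 r × 𝕜 → ℝ) (L : Fin p → Fin p → Space 𝕜 r × 𝕜 → 𝕜)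
    (q : Space 𝕜 r × 𝕜) : Matrix (Fin p) (Fin p) 𝕜 :=
  Matrix.of fun k l => (ρ q ^ 2)⁻¹ • L l k q

theorem norm_inv_sq_smul_le {a C b x : ℝ} {z : 𝕜} (hb : |C| ≤ b) (hx : 0 ≤ x)
    (h : ‖z‖ / a ^ 2 ≤ C * x) : ‖(a ^ 2)⁻¹ • z‖ ≤ b * x := by
  rw [norm_smul, Real.norm_of_nonneg (by positivity), inv_mul_eq_div]
  exact h.trans (mul_le_mul_of_nonneg_right ((le_abs_self C).trans hb) hx)

theorem sum_smul_colMat (L : Fin p → Fin p → 𝕜) (A : Matrix (Fin n) (Fin p) 𝕜) :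
    ∑ l, ∑ k, L l k • colMat l k A = A * Matrix.of fun k l => L l k := by
  ext i j
  simp only [Matrix.sum_apply, Matrix.smul_apply, colMat, Matrix.of_apply, Matrix.mul_apply,
    smul_eq_mul, mul_ite, mul_zero]
  rw [Finset.sum_comm]
  simp [mul_comm]

theorem sum_smul_rowMat (S : Fin n → Fin n → 𝕜) (A : Matrix (Fin n) (Fin p) 𝕜) :
    ∑ a, ∑ b, S a b • rowMat a b A = Matrix.of S * A := by
  ext i j
  simp only [Matrix.sum_apply, Matrix.smul_apply, rowMat, Matrix.of_apply, Matrix.mul_apply,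
    smul_eq_mul, mul_ite, mul_zero]
  rw [Finset.sum_comm]
  simp

theorem fderiv_apply_one_eq {M : Space 𝕜 r × 𝕜 → Matrix (Fin n) (Fin p) 𝕜} {q : Space 𝕜 r × 𝕜}
    {i : Fin n} {j : Fin p} (h : DifferentiableAt 𝕜 (fun q => M q i j) q) (c : Fin r → 𝕜) :
    fderiv 𝕜 (fun q => M q i j) q (∑ k, c k • EuclideanSpace.single k (1 : 𝕜), 1) =
      (∑ k, c k • partialX M k q + partialT M q) i j := by
  have hq : HasFDerivAt (fun q => M q i j) (fderiv 𝕜 (fun q => M q i j) q) (q.1, q.2) :=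
    h.hasFDerivAt
  have h1 := (HasFDerivAt.comp (f := fun x => (x, q.2)) q.1 hq
    (hasFDerivAt_prodMk_left (𝕜 := 𝕜) q.1 q.2)).fderiv
  have h2 := (hq.comp_hasDerivAt q.2
    ((hasDerivAt_const q.2 q.1).prodMk (hasDerivAt_id q.2))).deriv
  have h3 : ((∑ k, c k • EuclideanSpace.single k (1 : 𝕜), 1) : Space 𝕜 r × 𝕜) =
      ContinuousLinearMap.inl 𝕜 (Space 𝕜 r) 𝕜 (∑ k, c k • EuclideanSpace.single k (1 : 𝕜))
        + (0, 1) := by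
    rw [ContinuousLinearMap.inl_apply, Prod.mk_add_mk, add_zero, zero_add]
  have h4 : partialT M q i j = fderiv 𝕜 (fun q => M q i j) q (0, 1) := h2
  have h5 (k) : partialX M k q i j = fderiv 𝕜 (fun q => M q i j) q
      (ContinuousLinearMap.inl 𝕜 (Space 𝕜 r) 𝕜 (EuclideanSpace.single k (1 : 𝕜))) :=
    DFunLike.congr_fun h1 (EuclideanSpace.single k (1 : 𝕜))
  rw [h3, map_add, map_sum, map_sum, Matrix.add_apply, h4, Matrix.sum_apply]
  simp only [map_smul, Matrix.smul_apply, h5]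

/-- The infinitesimal triviality equation, divided by `ρ²`: the derivative of `M` along `V + ∂/∂t` is
`M P + Q M`. -/
theorem fderiv_liftField {M : Space 𝕜 r × 𝕜 → Matrix (Fin n) (Fin p) 𝕜} {q : Space 𝕜 r × 𝕜}
    {ρ : Space 𝕜 r × 𝕜 → ℝ} {ξ : Fin r → Space 𝕜 r × 𝕜 → 𝕜}
    {L : Fin p → Fin p → Space 𝕜 r × 𝕜 → 𝕜} {S : Fin n → Fin n → Space 𝕜 r × 𝕜 → 𝕜}
    (hM : ∀ i j, DifferentiableAt 𝕜 (fun q => M q i j) q) (hρ : ρ q ≠ 0)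
    (heq : ((ρ q : 𝕜) ^ 2) • partialT M q = ∑ i, ξ i q • partialX M i q
      + ∑ l, ∑ k, L l k q • colMat l k (M q) + ∑ a, ∑ b, S a b q • rowMat a b (M q))
    (i : Fin n) (j : Fin p) :
    fderiv 𝕜 (fun q => M q i j) q (liftField ρ ξ q, 1) =
      (M q * colCoeff ρ L q + rowCoeff ρ S q * M q) i j := by
  rw [liftField, fderiv_apply_one_eq (hM i j)]
  refine congrArg (fun A : Matrix (Fin n) (Fin p) 𝕜 => A i j) ?_
  rw [sum_smul_colMat, sum_smul_rowMat] at heq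
  have hρ' : ((ρ q : 𝕜) ^ 2) ≠ 0 := pow_ne_zero 2 (RCLike.ofReal_ne_zero.2 hρ)
  have hsm (z : 𝕜) : (ρ q ^ 2)⁻¹ • z = ((ρ q : 𝕜) ^ 2)⁻¹ * z := by
    rw [RCLike.real_smul_eq_coe_mul]
    push_cast
    rfl
  have hcol : colCoeff ρ L q = ((ρ q : 𝕜) ^ 2)⁻¹ • Matrix.of fun k l => L l k q := by
    ext k l
    simp [colCoeff, hsm]
  have hrow : rowCoeff ρ S q = ((ρ q : 𝕜) ^ 2)⁻¹ • Matrix.of fun a b => S a b q := by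
    ext a b
    simp [rowCoeff, hsm]
  have hT : partialT M q = ((ρ q : 𝕜) ^ 2)⁻¹ • (∑ i, ξ i q • partialX M i q
      + M q * (Matrix.of fun k l => L l k q) + (Matrix.of fun a b => S a b q) * M q) := by
    rw [← heq, inv_smul_smul₀ hρ']
  rw [hcol, hrow, hT]
  simp only [hsm, neg_smul, Finset.sum_neg_distrib, smul_add, Matrix.mul_smul, Matrix.smul_mul,
    Finset.smul_sum, smul_smul]
  abel

theorem eventually_isLiftingData {M : Space 𝕜 r × 𝕜 → Matrix (Fin n) (Fin p) 𝕜}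
    {ρ : Space 𝕜 r × 𝕜 → ℝ} {ξ : Fin r → Space 𝕜 r × 𝕜 → 𝕜}
    {L : Fin p → Fin p → Space 𝕜 r × 𝕜 → 𝕜} {S : Fin n → Fin n → Space 𝕜 r × 𝕜 → 𝕜}
    (hM : ∀ i j, AnalyticAt 𝕜 (fun q => M q i j) 0) (hρ : IsControlFunction ρ)
    (hξ : ∀ i, AnalyticAt ℝ (ξ i) 0) (hL : ∀ l k, AnalyticAt ℝ (L l k) 0)
    (hS : ∀ a b, AnalyticAt ℝ (S a b) 0)
    (heq : ∀ᶠ q in 𝓝 (0 : Space 𝕜 r × 𝕜), ((ρ q : 𝕜) ^ 2) • partialT M q =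
      ∑ i, ξ i q • partialX M i q + ∑ l, ∑ k, L l k q • colMat l k (M q)
        + ∑ a, ∑ b, S a b q • rowMat a b (M q))
    {C₁ C₂ C₃ : ℝ}
    (hξC : ∀ᶠ q in 𝓝 (0 : Space 𝕜 r × 𝕜), q.1 ≠ 0 → ∀ i, ‖ξ i q‖ / ρ q ^ 2 ≤ C₁ * ‖q.1‖)
    (hLC : ∀ᶠ q in 𝓝 (0 : Space 𝕜 r × 𝕜), q.1 ≠ 0 → ∀ l k, ‖L l k q‖ / ρ q ^ 2 ≤ C₂ * ‖q.1‖)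
    (hSC : ∀ᶠ q in 𝓝 (0 : Space 𝕜 r × 𝕜), q.1 ≠ 0 → ∀ a b, ‖S a b q‖ / ρ q ^ 2 ≤ C₃ * ‖q.1‖) :
    ∀ᶠ q in 𝓝 (0 : Space 𝕜 r × 𝕜), IsLiftingData M (liftField ρ ξ) (rowCoeff ρ S)
      (colCoeff ρ L) (r * |C₁| + |C₂| + |C₃|) q := by
  obtain ⟨c, hc, α, -, hcα⟩ := hρ.lojasiewicz
  have haxis : ∀ᶠ q in 𝓝 (0 : Space 𝕜 r × 𝕜), ρ (0, q.2) = 0 :=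
    (continuous_snd.tendsto (0 : Space 𝕜 r × 𝕜)).eventually hρ.zero_axis
  have hM' : ∀ᶠ q in 𝓝 (0 : Space 𝕜 r × 𝕜), ∀ i j, AnalyticAt 𝕜 (fun q => M q i j) q :=
    eventually_all.2 fun i => eventually_all.2 fun j => (hM i j).eventually_analyticAt
  have hξ' : ∀ᶠ q in 𝓝 (0 : Space 𝕜 r × 𝕜), ∀ i, AnalyticAt ℝ (ξ i) q :=
    eventually_all.2 fun i => (hξ i).eventually_analyticAt
  have hL' : ∀ᶠ q in 𝓝 (0 : Space 𝕜 r × 𝕜), ∀ l k, AnalyticAt ℝ (L l k) q :=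
    eventually_all.2 fun l => eventually_all.2 fun k => (hL l k).eventually_analyticAt
  have hS' : ∀ᶠ q in 𝓝 (0 : Space 𝕜 r × 𝕜), ∀ a b, AnalyticAt ℝ (S a b) q :=
    eventually_all.2 fun a => eventually_all.2 fun b => (hS a b).eventually_analyticAt
  filter_upwards [hcα, haxis, hM', hξ', hL', hS', heq, hξC, hLC, hSC, hρ.smooth] with q hcq hq0
    hMq hξq hLq hSq heq hξC hLC hSC hsm
  have hρq (h0 : q.1 ≠ 0) : ρ q ≠ 0 :=
    ((mul_pos hc (Real.rpow_pos_of_pos (norm_pos_iff.2 h0) α)).trans_le hcq).ne'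
  have hρ0 (h0 : q.1 = 0) : ρ q = 0 := by
    have : q = (0, q.2) := Prod.ext h0 rfl
    rw [this, hq0]
  have hinv (h0 : q.1 ≠ 0) : ContDiffAt ℝ 1 (fun q => (ρ q ^ 2)⁻¹) q :=
    ((hsm h0).pow 2).inv (pow_ne_zero 2 (hρq h0))
  have hC₁ := mul_nonneg (Nat.cast_nonneg r) (abs_nonneg C₁)
  have hC₂ := abs_nonneg C₂
  have hC₃ := abs_nonneg C₃
  have hx := norm_nonneg q.1
  have hdiff (i j) : DifferentiableAt 𝕜 (fun q => M q i j) q := (hMq i j).differentiableAt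
  refine ⟨hdiff, fun h0 => ?_, fun h0 a b => (hinv h0).smul (hSq a b).contDiffAt,
    fun h0 k l => (hinv h0).smul (hLq l k).contDiffAt, ?_, fun a b => ?_, fun k l => ?_,
    fun h0 => fderiv_liftField hdiff (hρq h0) heq⟩
  · exact ContDiffAt.sum fun i _ =>
      ((hinv h0).smul (hξq i).contDiffAt).neg.smul contDiffAt_const
  · rcases eq_or_ne q.1 0 with h0 | h0
    · simp [liftField, hρ0 h0, h0]
    · have h1 : ‖liftField ρ ξ q‖ ≤ ∑ _i : Fin r, |C₁| * ‖q.1‖ := by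
        refine norm_sum_le_of_le _ fun i _ => ?_
        rw [norm_smul, norm_neg, PiLp.norm_single, norm_one, mul_one]
        exact norm_inv_sq_smul_le le_rfl hx (hξC h0 i)
      rw [Finset.sum_const, Finset.card_univ, Fintype.card_fin, nsmul_eq_mul, ← mul_assoc] at h1
      exact h1.trans (mul_le_mul_of_nonneg_right (by linarith) hx)
  · rcases eq_or_ne q.1 0 with h0 | h0
    · simp [rowCoeff, hρ0 h0, h0]
    · exact norm_inv_sq_smul_le (by linarith) hx (hSC h0 a b)
  · rcases eq_or_ne q.1 0 with h0 | h0
    · simp [colCoeff, hρ0 h0, h0]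
    · exact norm_inv_sq_smul_le (by linarith) hx (hLC h0 l k)

/-- The ambient space has positive dimension: the dimension of a quotient of `𝒪_r` plus `2` cannot
be `0`. -/
theorem IsCodimTwoCMIsolatedSingularity.nontrivial_space
    {M₀ : Space 𝕜 r → Matrix (Fin n) (Fin (n + 1)) 𝕜}
    (h : IsCodimTwoCMIsolatedSingularity M₀) : Nontrivial (Space 𝕜 r) := by
  have hr : r ≠ 0 := by
    rintro rfl
    have h1 := h.codim_two
    generalize ringKrullDim (AnalyticGerms 𝕜 0 ⧸ minorIdeal M₀) = d at h1
    cases d with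
    | bot => simp at h1
    | coe d =>
      have h2 : ((d + 2 : ℕ∞) : WithBot ℕ∞) = ((0 : ℕ∞) : WithBot ℕ∞) := h1
      have h3 := WithBot.coe_injective h2
      simp at h3
  have : NeZero r := ⟨hr⟩
  infer_instance

end Germs

end CM2

theorem proposition5p1 {𝕜 : Type*} [RCLike 𝕜] (r n : ℕ)
    (M₀ : CM2.Space 𝕜 r → Matrix (Fin n) (Fin (n + 1)) 𝕜)
    (hM₀ : CM2.IsCodimTwoCMIsolatedSingularity M₀)
    (M : CM2.Space 𝕜 r × 𝕜 → Matrix (Fin n) (Fin (n + 1)) 𝕜)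
    (hM : CM2.IsDeformation M₀ M)
    (ρ : CM2.Space 𝕜 r × 𝕜 → ℝ) (hρ : CM2.IsControlFunction ρ)
    (ξ : Fin r → CM2.Space 𝕜 r × 𝕜 → 𝕜)
    (L : Fin (n + 1) → Fin (n + 1) → CM2.Space 𝕜 r × 𝕜 → 𝕜)
    (S : Fin n → Fin n → CM2.Space 𝕜 r × 𝕜 → 𝕜)
    (hξ : ∀ i, AnalyticAt ℝ (ξ i) 0)
    (hL : ∀ l k, AnalyticAt ℝ (L l k) 0)
    (hS : ∀ a b, AnalyticAt ℝ (S a b) 0)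
    (heq : ∀ᶠ q in nhds (0 : CM2.Space 𝕜 r × 𝕜),
      ((ρ q : 𝕜) ^ 2) • CM2.partialT M q =
        ∑ i, ξ i q • CM2.partialX M i q
          + ∑ l, ∑ k, L l k q • CM2.colMat l k (M q)
          + ∑ a, ∑ b, S a b q • CM2.rowMat a b (M q))
    (C₁ C₂ C₃ : ℝ)
    (hξ_bound : ∀ᶠ q in nhds (0 : CM2.Space 𝕜 r × 𝕜), q.1 ≠ 0 →
      ∀ i, ‖ξ i q‖ / ρ q ^ 2 ≤ C₁ * ‖q.1‖)
    (hL_bound : ∀ᶠ q in nhds (0 : CM2.Space 𝕜 r × 𝕜), q.1 ≠ 0 →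
      ∀ l k, ‖L l k q‖ / ρ q ^ 2 ≤ C₂ * ‖q.1‖)
    (hS_bound : ∀ᶠ q in nhds (0 : CM2.Space 𝕜 r × 𝕜), q.1 ≠ 0 →
      ∀ a b, ‖S a b q‖ / ρ q ^ 2 ≤ C₃ * ‖q.1‖)
    (hξ_zero : ∀ᶠ t in nhds (0 : 𝕜), ∀ i, ξ i (0, t) = 0) :
    CM2.IsC0GTrivial M₀ M := by
  have := hM₀.nontrivial_space
  exact CM2.isC0GTrivial_of_liftingData (by positivity)
    (CM2.eventually_isLiftingData hM.analytic hρ hξ hL hS heq hξ_bound hL_bound hS_bound) hM.restrict
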